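/- Let $k$ be a field, $n,s,l\ge 0$ integers, $k(L)=k(a_0,\dots,a_n)$, let $A$ be a commutative $k$-algebra and $A_L=A\otimes_k k(L)$. Let $\mathbb G$ be the Grassmannian over $k$ of codimension $l$ subspaces of $k^s$: for a $k$-algebra $R$, a $k$-morphism $\operatorname{Spec}R\to\mathbb G$ is a submodule $W\subset R^s$ such that $R^s/W$ is locally free of rank $l$. If $R^s/W$ is free with basis $F$, the determinants $P_i=\det_F(\bar e_{i_1},\dots,\bar e_{i_l})$, $i=(i_1,\dots,i_l)\in\{1,\dots,s\}^l$, are called Plücker coordinates of this morphism (they depend on $F$ only through a common unit). For a $k$-morphism $f:X\to\mathbb G$, a family $(p_i(j))_{i\in\{1,\dots,s\}^l,\ j\in J}$ of global sections of $\mathcal O_X$ is a superabundant family of Plücker coordinates for $f$ if for every $x\in X$ there is $j_x\in J$ such that the germs at $x$ of $(p_i(j_x))_i$ are Plücker coordinates of the localized morphism $\operatorname{Spec}\mathcal O_{X,x}\to\mathbb G$, and for every $j\in J$ there is $b_j\in\mathcal O_{X,x}$ with $p_i(j)=b_j\,p_i(j_x)$ in $\mathcal O_{X,x}$ for all $i$.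 A morphism $X\to Y$ is called schematically dominant if it factors through no closed subscheme of $Y$ other than $Y$. Let $e:U_{A,L}\hookrightarrow\operatorname{Spec}A_L$ be a schematically dominant open embedding such that the first projection $pr_1:U_{A,L}\to\operatorname{Spec}A$ is schematically dominant, and such that every closed point of $\operatorname{Spec}A$ is the image under $pr_1$ of a point of $U_{A,L}$. Let $h_{A,L}:U_{A,L}\to\mathbb G$ be a $k$-morphism, and let $p_i(j)\in A[a_0,\dots,a_n]$ ($i\in\{1,\dots,s\}^l$, $j\in J$, for an arbitrary set $J$) be such that the restrictions $e^*(p_i(j))\in\mathcal O_{U_{A,L}}(U_{A,L})$ form a superabundant family of Plücker coordinates for $h_{A,L}$. For $\alpha\in\mathbb N^{n+1}$ let $p_i^\alpha(j)\in A$ be the coefficient of $a_0^{\alpha_0}\cdots a_n^{\alpha_n}$ in $p_i(j)$. Then the following are equivalent: 1. there is a $k$-morphism $h:\operatorname{Spec}A\to\mathbb G$ with $h_{A,L}=h\circ pr_1$; 2. for all $i_1,i_2,j_1,j_2,\alpha_1,\alpha_2$ one has $p_{i_1}^{\alpha_1}(j_1)\,p_{i_2}^{\alpha_2}(j_2)=p_{i_2}^{\alpha_1}(j_1)\,p_{i_1}^{\alpha_2}(j_2)$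 in $A$. -/

import Mathlib

open CategoryTheory AlgebraicGeometry Opposite
open scoped TensorProduct

universe u

namespace GrassmannianFactorisation

section Grassmannian

variable (k : Type u) [Field k]

/-- `Spec R` as a scheme over `Spec k`, for a commutative `k`-algebra `R`. -/
noncomputable abbrev specOver (R : Type u) [CommRing R] [Algebra k R] :
    Over (Spec (CommRingCat.of k)) :=
  (algSpec (CommRingCat.of k)).obj (op (CommAlgCat.of k R))

/-- The functor of points of a `k`-scheme `X`, restricted to affine `k`-schemes:
it sends a commutative `k`-algebra `R` to the set of `k`-morphisms `Spec R ⟶ X`. -/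
noncomputable abbrev points (X : Over (Spec (CommRingCat.of k))) :
    CommAlgCat.{u} k ⥤ Type u :=
  (algSpec (CommRingCat.of k)).rightOp ⋙ yoneda.obj X

/-- The Grassmannian of `k ^ s`, classifying quotients of rank `l` (that is, subspaces of
codimension `l`), given by its functor of points: it sends a commutative `k`-algebra `R` to the set
of submodules `W` of `R ⊗ k ^ s` whose quotient is locally free of rank `l`, and a homomorphism
`R → R'` acts by base change. -/
noncomputable abbrev grassmannian (s l : ℕ) : CommAlgCat.{u} k ⥤ Type u :=
  Module.Grassmannian.functor (R := k) (M := Fin s → k) l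

variable {k}

/-- A `k`-morphism from a `k`-scheme `X` to the Grassmannian: a rule assigning to every `k`-morphism
`Spec R ⟶ X` an `R`-point of the Grassmannian, compatibly with base change. As schemes
embed fully faithfully into functors on commutative algebras, these are the morphisms of
`k`-schemes from `X` to the scheme representing `grassmannian k s l`. -/
abbrev GrassmannianMorphism (X : Over (Spec (CommRingCat.of k))) (s l : ℕ) : Type (u + 1) :=
  points k X ⟶ grassmannian k s l

/-- The composition of a morphism `g : Y ⟶ X` with a morphism `f` from `X` to a Grassmannian. -/
noncomputable def GrassmannianMorphism.precomp {X Y : Over (Spec (CommRingCat.of k))} {s l : ℕ}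
    (f : GrassmannianMorphism X s l) (g : Y ⟶ X) : GrassmannianMorphism Y s l :=
  Functor.whiskerLeft _ (yoneda.map g) ≫ f

/-- The local ring of a `k`-scheme at a point, as a `k`-algebra. -/
noncomputable def stalkAlgebra (X : Over (Spec (CommRingCat.of k))) (x : X.left) :
    CommAlgCat.{u} k :=
  letI : Algebra k (X.left.presheaf.stalk x) :=
    (Spec.preimage (X.left.fromSpecStalk x ≫ X.hom)).hom.toAlgebra
  CommAlgCat.of k (X.left.presheaf.stalk x)

/-- The canonical morphism `Spec 𝒪_{X,x} ⟶ X`, as a morphism over `Spec k`. -/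
noncomputable def stalkPoint (X : Over (Spec (CommRingCat.of k))) (x : X.left) :
    (points k X).obj (stalkAlgebra X x) :=
  Over.homMk (X.left.fromSpecStalk x) (Spec.map_preimage _).symm

/-- The localization at `x` of a morphism from `X` to a Grassmannian, namely its restriction to
`Spec 𝒪_{X,x}`, seen as an `𝒪_{X,x}`-point of the Grassmannian. -/
noncomputable def GrassmannianMorphism.localize {X : Over (Spec (CommRingCat.of k))} {s l : ℕ}
    (f : GrassmannianMorphism X s l) (x : X.left) :
    Module.Grassmannian (stalkAlgebra X x) (stalkAlgebra X x ⊗[k] (Fin s → k)) l :=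
  f.app (stalkAlgebra X x) (stalkPoint X x)

/-- The germ at `x` of a global section, as an element of `𝒪_{X,x}`. -/
noncomputable def germAt (X : Over (Spec (CommRingCat.of k))) (x : X.left)
    (t : Γ(X.left, ⊤)) : stalkAlgebra X x :=
  (X.left.presheaf.germ ⊤ x trivial).hom t

/-- `P` is a family of Plücker coordinates for an `R`-point `W ⊆ R ^ s` of the Grassmannian:
for some basis `F` of `R ^ s / W` with `l` elements and all indices `i₁, …, i_l`, the element
`P (i₁, …, i_l)` is the determinant, with respect to `F`, of the classes of the canonical basis
vectors `e_{i₁}, …, e_{i_l}`. -/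
def IsPluckerCoordinates {R : Type u} [CommRing R] [Algebra k R] {s l : ℕ}
    (W : Module.Grassmannian R (R ⊗[k] (Fin s → k)) l) (P : (Fin l → Fin s) → R) : Prop :=
  ∃ F : Module.Basis (Fin l) R ((R ⊗[k] (Fin s → k)) ⧸ W.toSubmodule),
    ∀ i : Fin l → Fin s,
      P i = F.det fun m => W.toSubmodule.mkQ (1 ⊗ₜ[k] (Pi.single (i m) 1 : Fin s → k))

/-- A superabundant family of Plücker coordinates for a morphism `f` from `X` to a Grassmannian:
a family of global sections `p j i` of `𝒪_X` such that, at every point `x`, there is an index `j₀`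
for which the germs of the `p j₀ i` are Plücker coordinates of the localization of `f` at `x`,
while for every `j` the germs of the `p j i` are a common multiple of the germs of the `p j₀ i`. -/
def IsSuperabundant {X : Over (Spec (CommRingCat.of k))} {s l : ℕ}
    (f : GrassmannianMorphism X s l) {J : Type*} (p : J → (Fin l → Fin s) → Γ(X.left, ⊤)) : Prop :=
  ∀ x : X.left, ∃ j₀ : J,
    IsPluckerCoordinates (f.localize x) (fun i => germAt X x (p j₀ i)) ∧
    ∀ j : J, ∃ b : stalkAlgebra X x, ∀ i, germAt X x (p j i) = b * germAt X x (p j₀ i)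

end Grassmannian

section GenericLinearForm

variable (k : Type u) [Field k] (A : Type u) [CommRing A] [Algebra k A] (n : ℕ)

/-- The field `k(L) = k(a₀, …, a_n)` of rational functions. -/
abbrev RatFun : Type u := FractionRing (MvPolynomial (Fin (n + 1)) k)

/-- The `k`-algebra `A_L = A ⊗ k(L)`. -/
abbrev GenericExtension : Type u := A ⊗[k] RatFun k n

/-- The canonical map `A[a₀, …, a_n] = A ⊗ k[a₀, …, a_n] → A ⊗ k(a₀, …, a_n) = A_L`. -/
noncomputable def ofPolynomial :
    MvPolynomial (Fin (n + 1)) A →ₐ[A] GenericExtension k A n :=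
  MvPolynomial.aeval fun m => 1 ⊗ₜ[k] algebraMap (MvPolynomial (Fin (n + 1)) k) (RatFun k n)
    (MvPolynomial.X m)

/-- The first projection `Spec A_L ⟶ Spec A`. -/
noncomputable def firstProjection :
    specOver k (GenericExtension k A n) ⟶ specOver k A :=
  (algSpec (CommRingCat.of k)).map (CommAlgCat.ofHom
    (Algebra.TensorProduct.includeLeft : A →ₐ[k] GenericExtension k A n)).op

variable {k A n}

/-- The pullback `e^* : A_L → 𝒪_U(U)` of functions along a `k`-morphism `e : U ⟶ Spec A_L`. -/
noncomputable def pullbackFunction {U : Over (Spec (CommRingCat.of k))}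
    (e : U ⟶ specOver k (GenericExtension k A n)) (t : GenericExtension k A n) : Γ(U.left, ⊤) :=
  e.left.appTop.hom ((Scheme.ΓSpecIso (CommRingCat.of (GenericExtension k A n))).inv.hom t)

end GenericLinearForm

end GrassmannianFactorisation

/-!
A `k`-morphism `Spec A ⟶ 𝔾` is the kernel of an idempotent matrix `Φ` over `A`, and Plücker
coordinates of a surjective matrix are its maximal minors.

If `h` descends to the point given by `Φ`, then for every choice of `l` rows the `l × l` minors of
`Φ` in these rows are, in every local ring of `U`, a common multiple of the Plücker coordinates of
`h`, and so is each `p j`. Hence the two families are proportional over `A[a₀, …, a_n]`, which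
embeds into the functions on `U`, and reading off coefficients, each `p^α j` is proportional to each
of these families of minors. As `U` meets the fibre of every closed point of `Spec A`, the minors
generate the unit ideal of `A`, and proportionality is transitive through them.

Conversely, if the coefficient families are proportional, then in every local ring of `U` they are
multiples of the Plücker coordinates of `h`, and they generate the unit ideal of `A`. By Cramer's
rule each coefficient family yields matrices that are locally multiples of a projector along `h`,
and a combination of these given by a partition of unity over `A` is a projector along `h` in every
local ring. It is idempotent over `A` because `A` embeds into the product of these rings, and its
kernel is the required point of `𝔾`.
-/

namespace GrassmannianFactorisation

section Proportional

variable {I R S : Type*} [CommSemiring R] [CommSemiring S]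

/-- Two families of elements of a commutative semiring are proportional if all cross products
agree. This is the relation between two systems of homogeneous coordinates of one point, written
without division. It is not transitive in general, but it is through families generating the unit
ideal. -/
def IsProportional (u v : I → R) : Prop :=
  ∀ i i', u i * v i' = u i' * v i

theorem isProportional_mul_left (b c : R) (w : I → R) :
    IsProportional (fun i => b * w i) (fun i => c * w i) :=
  fun i i' => by ring

theorem IsProportional.symm {u v : I → R} (h : IsProportional u v) : IsProportional v u :=
  fun i i' => by rw [mul_comm, ← h, mul_comm]

theorem IsProportional.map {u v : I → R} (h : IsProportional u v) (f : R →+* S) :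
    IsProportional (fun i => f (u i)) (fun i => f (v i)) :=
  fun i i' => by simp only [← map_mul, h i i']

theorem IsProportional.exists_eq_mul_of_isUnit {u v : I → R} (h : IsProportional u v) {i₀ : I}
    (hi₀ : IsUnit (v i₀)) : ∃ c, ∀ i, u i = c * v i := by
  obtain ⟨w, hw⟩ := hi₀.exists_right_inv
  refine ⟨u i₀ * w, fun i => ?_⟩
  calc u i = u i * v i₀ * w := by rw [mul_assoc, hw, mul_one]
    _ = u i₀ * w * v i := by rw [h i i₀, mul_right_comm]

theorem IsProportional.trans_of_span_eq_top {T : Type*} {u v : I → R} {w : T → I → R}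
    (hw : Ideal.span (Set.range fun ti : T × I => w ti.1 ti.2) = ⊤)
    (hu : ∀ t, IsProportional u (w t)) (hv : ∀ t, IsProportional v (w t)) :
    IsProportional u v := by
  intro i i'
  have hgen : Set.EqOn (LinearMap.toSpanSingleton R R (u i * v i'))
      (LinearMap.toSpanSingleton R R (u i' * v i))
      (Set.range fun ti : T × I => w ti.1 ti.2) := by
    rintro _ ⟨⟨t, i''⟩, rfl⟩
    calc w t i'' * (u i * v i') = u i * w t i'' * v i' := by ring
      _ = u i'' * (v i' * w t i) := by rw [hu t i i'']; ring
      _ = u i'' * w t i' * v i := by rw [hv t i' i]; ring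
      _ = w t i'' * (u i' * v i) := by rw [hu t i'' i']; ring
  simpa only [LinearMap.toSpanSingleton_apply, one_smul] using
    LinearMap.eqOn_span hgen (hw ▸ Submodule.mem_top : (1 : R) ∈ Ideal.span _)

theorem isProportional_C_iff {σ : Type*} {u : I → R} {P : I → MvPolynomial σ R} :
    IsProportional (fun i => MvPolynomial.C (u i)) P ↔
      ∀ α, IsProportional u fun i => (P i).coeff α := by
  simp only [IsProportional, MvPolynomial.ext_iff, MvPolynomial.coeff_C_mul]
  exact ⟨fun h α i i' => h i i' α, fun h i i' α => h α i i'⟩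

end Proportional

section MaximalMinors

variable {R κ ι : Type*} [CommRing R] [Fintype κ] [DecidableEq κ]

/-- The maximal minor of `M` on a sequence of columns. Following the Plücker coordinates, the
columns may repeat and come in any order. -/
def maximalMinor (M : Matrix κ ι R) (i : κ → ι) : R :=
  (M.submatrix id i).det

theorem det_submatrix_mul (B : Matrix ι κ R) (M : Matrix κ ι R) (c i : κ → ι) :
    ((B * M).submatrix c i).det = maximalMinor B.transpose c * maximalMinor M i := by
  rw [Matrix.submatrix_mul B M c id i Function.bijective_id, Matrix.det_mul, maximalMinor,
    ← Matrix.det_transpose (B.submatrix c id), Matrix.transpose_submatrix, maximalMinor]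

theorem adjugate_submatrix_mul (M : Matrix κ ι R) (i : κ → ι) :
    (M.submatrix id i).adjugate * M =
      Matrix.of fun m r => maximalMinor M (Function.update i m r) := by
  ext m r
  change ((M.submatrix id i).adjugate.mulVec fun a => M a r) m = _
  rw [← Matrix.cramer_eq_adjugate_mulVec, Matrix.cramer_apply, Matrix.of_apply, maximalMinor]
  congr 1
  ext a b
  rcases eq_or_ne b m with rfl | hb
  · simp
  · simp [hb]

variable [Fintype ι]

theorem det_mul_eq_sum_maximalMinor (M : Matrix κ ι R) (N : Matrix ι κ R) :
    (M * N).det = ∑ i : κ → ι, (∏ m, N (i m) m) * maximalMinor M i := by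
  classical
  have hrow : (M * N).transpose = fun m => ∑ r, N r m • M.transpose r := by
    ext m m'
    simp [Matrix.mul_apply, mul_comm]
  rw [← Matrix.det_transpose, hrow]
  refine ((Matrix.detRowAlternating (R := R) (n := κ)).toMultilinearMap.map_sum
    fun m r => N r m • M.transpose r).trans (Finset.sum_congr rfl fun i _ => ?_)
  rw [MultilinearMap.map_smul_univ, maximalMinor, ← Matrix.det_transpose]
  rfl

theorem exists_isUnit_maximalMinor [IsLocalRing R] {M : Matrix κ ι R} {N : Matrix ι κ R}
    (h : M * N = 1) : ∃ i, IsUnit (maximalMinor M i) := by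
  have hsum : IsUnit (∑ i : κ → ι, (∏ m, N (i m) m) * maximalMinor M i) := by
    rw [← det_mul_eq_sum_maximalMinor, h, Matrix.det_one]
    exact isUnit_one
  obtain ⟨i, -, hi⟩ := IsLocalRing.exists_of_isUnit_sum hsum
  exact ⟨i, isUnit_of_mul_isUnit_right hi⟩

end MaximalMinors

section Projectors

variable {R κ ι : Type*} [CommRing R] [Fintype κ] [DecidableEq κ] [Fintype ι]

/-- `Φ` is a projector along `M` if it factors through `M` by means of a right inverse of `M`. Then
`Φ` is an idempotent matrix with the same kernel as the surjective matrix `M`. -/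
def IsProjectorAlong (Φ : Matrix ι ι R) (M : Matrix κ ι R) : Prop :=
  ∃ B : Matrix ι κ R, Φ = B * M ∧ M * B = 1

theorem IsProjectorAlong.isIdempotentElem {Φ : Matrix ι ι R} {M : Matrix κ ι R}
    (h : IsProjectorAlong Φ M) : IsIdempotentElem Φ := by
  obtain ⟨B, rfl, hMB⟩ := h
  rw [IsIdempotentElem, Matrix.mul_assoc, ← Matrix.mul_assoc M, hMB, Matrix.one_mul]

theorem IsProjectorAlong.exists_det_submatrix_eq_mul [IsLocalRing R] {Φ : Matrix ι ι R}
    {M : Matrix κ ι R} (h : IsProjectorAlong Φ M) :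
    ∃ β : (κ → ι) → R, (∃ c, IsUnit (β c)) ∧
      ∀ c i, (Φ.submatrix c i).det = β c * maximalMinor M i := by
  obtain ⟨B, rfl, hMB⟩ := h
  refine ⟨maximalMinor B.transpose, exists_isUnit_maximalMinor (N := M.transpose) ?_,
    det_submatrix_mul B M⟩
  rw [← Matrix.transpose_mul, hMB, Matrix.transpose_one]

theorem isProjectorAlong_sum_smul {T : Type*} {t : Finset T} {a d : T → R}
    {Φ : T → Matrix ι ι R} {M : Matrix κ ι R}
    (hΦ : ∀ x, ∃ B : Matrix ι κ R, Φ x = B * M ∧ M * B = d x • 1)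
    (ha : ∑ x ∈ t, a x * d x = 1) : IsProjectorAlong (∑ x ∈ t, a x • Φ x) M := by
  choose B hB hMB using hΦ
  refine ⟨∑ x ∈ t, a x • B x, ?_, ?_⟩
  · simp only [Matrix.sum_mul, Matrix.smul_mul, hB]
  · simp only [Matrix.mul_sum, Matrix.mul_smul, hMB, smul_smul, ← Finset.sum_smul, ha, one_smul]

end Projectors

section ExchangeMatrix

variable {R κ ι : Type*} [CommRing R] [Fintype κ] [DecidableEq κ] [DecidableEq ι]

/-- The matrix built from a family `P` of Plücker coordinates by exchanging one entry of `i` at a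
time. By Cramer's rule it is `P i` times the projector onto the span of the basis vectors indexed by
`i`, along the subspace with Plücker coordinates `P`. -/
def exchangeMatrix (P : (κ → ι) → R) (i : κ → ι) : Matrix ι ι R :=
  (1 : Matrix ι ι R).submatrix id i * Matrix.of fun m r => P (Function.update i m r)

theorem map_exchangeMatrix {S : Type*} [CommRing S] (f : R →+* S) (P : (κ → ι) → R) (i : κ → ι) :
    (exchangeMatrix P i).map f = exchangeMatrix (fun i => f (P i)) i := by
  rw [exchangeMatrix, Matrix.map_mul, ← Matrix.submatrix_map, Matrix.map_one f f.map_zero f.map_one]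
  rfl

theorem exchangeMatrix_mul_left (c : R) (P : (κ → ι) → R) (i : κ → ι) :
    exchangeMatrix (fun i => c * P i) i = c • exchangeMatrix P i := by
  rw [exchangeMatrix, exchangeMatrix, ← Matrix.mul_smul]
  rfl

variable [Fintype ι]

theorem exists_exchangeMatrix_maximalMinor_eq_mul (M : Matrix κ ι R) (i : κ → ι) :
    ∃ B : Matrix ι κ R, exchangeMatrix (maximalMinor M) i = B * M ∧
      M * B = maximalMinor M i • 1 := by
  refine ⟨(1 : Matrix ι ι R).submatrix id i * (M.submatrix id i).adjugate, ?_, ?_⟩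
  · rw [exchangeMatrix, Matrix.mul_assoc, adjugate_submatrix_mul]
  · have hsub : M * (1 : Matrix ι ι R).submatrix id i = M.submatrix id i :=
      Matrix.mul_submatrix_one (Equiv.refl ι) i M
    rw [← Matrix.mul_assoc, hsub, Matrix.mul_adjugate, maximalMinor]

theorem isProjectorAlong_map_sum_exchangeMatrix {A T : Type*} [CommRing A] (f : A →+* R)
    {q : T → (κ → ι) → A} {t : Finset (T × (κ → ι))} {a : T × (κ → ι) → A} {M : Matrix κ ι R}
    (hq : ∀ x, ∃ c, ∀ i, f (q x i) = c * maximalMinor M i)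
    (ha : ∑ xi ∈ t, a xi * q xi.1 xi.2 = 1) :
    IsProjectorAlong ((∑ xi ∈ t, a xi • exchangeMatrix (q xi.1) xi.2).map f) M := by
  have hmap : (∑ xi ∈ t, a xi • exchangeMatrix (q xi.1) xi.2).map f =
      ∑ xi ∈ t, f (a xi) • exchangeMatrix (fun i => f (q xi.1 i)) xi.2 := by
    refine (map_sum f.mapMatrix _ t).trans (Finset.sum_congr rfl fun xi _ => ?_)
    rw [RingHom.mapMatrix_apply, Matrix.map_smul' _ _ _ (map_mul f), map_exchangeMatrix]
  rw [hmap]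
  refine isProjectorAlong_sum_smul (d := fun xi => f (q xi.1 xi.2)) (fun xi => ?_)
    (by simp only [← map_mul, ← map_sum, ha, map_one])
  obtain ⟨c, hc⟩ := hq xi.1
  obtain ⟨B, hB, hMB⟩ := exists_exchangeMatrix_maximalMinor_eq_mul M xi.2
  refine ⟨c • B, ?_, ?_⟩
  · rw [funext hc, exchangeMatrix_mul_left, hB, Matrix.smul_mul]
  · rw [Matrix.mul_smul, hMB, smul_smul, hc]

end ExchangeMatrix

section LocalToGlobal

variable {A : Type*} [CommRing A]

theorem span_eq_top_of_forall_exists_isUnit {X : Type*} {O : X → Type*} [∀ x, CommRing (O x)]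
    {φ : ∀ x, A →+* O x} (hφ : ∀ m : Ideal A, m.IsMaximal → ∃ x, ∀ a ∈ m, ¬IsUnit (φ x a))
    {s : Set A} (hs : ∀ x, ∃ a ∈ s, IsUnit (φ x a)) : Ideal.span s = ⊤ := by
  by_contra hne
  obtain ⟨m, hm, hle⟩ := Ideal.exists_le_maximal _ hne
  obtain ⟨x, hx⟩ := hφ m hm
  obtain ⟨a, has, ha⟩ := hs x
  exact hx a (hle (Ideal.subset_span has)) ha

theorem exists_isUnit_map_C_coeff {σ S : Type*} [CommRing S] [IsLocalRing S]
    {ψ : MvPolynomial σ A →+* S} {P : MvPolynomial σ A} (hP : IsUnit (ψ P)) :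
    ∃ α, IsUnit (ψ (MvPolynomial.C (P.coeff α))) := by
  have hsum : IsUnit (∑ α ∈ P.support,
      ψ (MvPolynomial.C (P.coeff α)) * ψ (MvPolynomial.monomial α 1)) := by
    simpa only [← map_mul, MvPolynomial.C_mul_monomial, mul_one, ← map_sum,
      MvPolynomial.support_sum_monomial_coeff] using hP
  obtain ⟨α, -, hα⟩ := IsLocalRing.exists_of_isUnit_sum hsum
  exact ⟨α, isUnit_of_mul_isUnit_left hα⟩

variable {κ ι σ J X : Type*} [Fintype κ] [DecidableEq κ] [Fintype ι] {O : X → Type*}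
  [∀ x, CommRing (O x)] [∀ x, IsLocalRing (O x)] {ψ : ∀ x, MvPolynomial σ A →+* O x}
  {M : ∀ x, Matrix κ ι (O x)} {p : J → (κ → ι) → MvPolynomial σ A}

theorem isProportional_coeff_of_isProjectorAlong (hψ : Function.Injective (RingHom.pi ψ))
    (hmax : ∀ m : Ideal A, m.IsMaximal → ∃ x, ∀ a ∈ m, ¬IsUnit (ψ x (MvPolynomial.C a)))
    (hp : ∀ x j, ∃ b, ∀ i, ψ x (p j i) = b * maximalMinor (M x) i)
    {Φ : Matrix ι ι A}
    (hΦ : ∀ x, IsProjectorAlong (Φ.map ((ψ x).comp MvPolynomial.C)) (M x))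
    (j₁ j₂ : J) (α₁ α₂ : σ →₀ ℕ) :
    IsProportional (fun i => (p j₁ i).coeff α₁) (fun i => (p j₂ i).coeff α₂) := by
  let Q (c i : κ → ι) : A := (Φ.submatrix c i).det
  have hQ (x : X) : ∃ β : (κ → ι) → O x, (∃ c, IsUnit (β c)) ∧
      ∀ c i, ψ x (MvPolynomial.C (Q c i)) = β c * maximalMinor (M x) i := by
    obtain ⟨β, hβ, hdet⟩ := (hΦ x).exists_det_submatrix_eq_mul
    exact ⟨β, hβ, fun c i => (RingHom.map_det ((ψ x).comp MvPolynomial.C) _).trans (hdet c i)⟩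
  have htop : Ideal.span (Set.range fun ci : (κ → ι) × (κ → ι) => Q ci.1 ci.2) = ⊤ := by
    refine span_eq_top_of_forall_exists_isUnit (φ := fun x => (ψ x).comp MvPolynomial.C) hmax
      fun x => ?_
    obtain ⟨β, ⟨c, hc⟩, hβ⟩ := hQ x
    obtain ⟨B, -, hMB⟩ := hΦ x
    obtain ⟨i, hi⟩ := exists_isUnit_maximalMinor hMB
    exact ⟨_, ⟨(c, i), rfl⟩, (hβ c i).symm ▸ hc.mul hi⟩
  have hcoeff (j : J) (α : σ →₀ ℕ) (c : κ → ι) :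
      IsProportional (Q c) (fun i => (p j i).coeff α) := by
    refine isProportional_C_iff.mp (fun i i' => hψ (funext fun x => ?_)) α
    obtain ⟨β, -, hβ⟩ := hQ x
    obtain ⟨b, hb⟩ := hp x j
    simpa only [Pi.mul_apply, RingHom.pi_apply, map_mul, hβ, hb] using
      isProportional_mul_left (β c) b (maximalMinor (M x)) i i'
  exact IsProportional.trans_of_span_eq_top htop (fun c => IsProportional.symm (hcoeff j₁ α₁ c))
    fun c => IsProportional.symm (hcoeff j₂ α₂ c)

theorem exists_isProjectorAlong_of_isProportional_coeff (hψ : Function.Injective (RingHom.pi ψ))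
    (hmax : ∀ m : Ideal A, m.IsMaximal → ∃ x, ∀ a ∈ m, ¬IsUnit (ψ x (MvPolynomial.C a)))
    (hM : ∀ x, ∃ i, IsUnit (maximalMinor (M x) i))
    (hp : ∀ x, ∃ j, ∀ i, ψ x (p j i) = maximalMinor (M x) i)
    (h : ∀ j₁ j₂ α₁ α₂,
      IsProportional (fun i => (p j₁ i).coeff α₁) (fun i => (p j₂ i).coeff α₂)) :
    ∃ Φ : Matrix ι ι A, IsIdempotentElem Φ ∧
      ∀ x, IsProjectorAlong (Φ.map ((ψ x).comp MvPolynomial.C)) (M x) := by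
  classical
  let q (t : J × (σ →₀ ℕ)) (i : κ → ι) : A := (p t.1 i).coeff t.2
  have hq (x : X) (t : J × (σ →₀ ℕ)) :
      ∃ c, ∀ i, ψ x (MvPolynomial.C (q t i)) = c * maximalMinor (M x) i := by
    obtain ⟨j, hj⟩ := hp x
    obtain ⟨i₀, hi₀⟩ := hM x
    have hprop := (isProportional_C_iff.mpr (h t.1 j t.2)).map (ψ x)
    simp only [hj] at hprop
    exact hprop.exists_eq_mul_of_isUnit hi₀
  have htop : Ideal.span (Set.range fun ti : (J × (σ →₀ ℕ)) × (κ → ι) => q ti.1 ti.2) = ⊤ := by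
    refine span_eq_top_of_forall_exists_isUnit (φ := fun x => (ψ x).comp MvPolynomial.C) hmax
      fun x => ?_
    obtain ⟨j, hj⟩ := hp x
    obtain ⟨i, hi⟩ := hM x
    obtain ⟨α, hα⟩ := exists_isUnit_map_C_coeff (ψ := ψ x) (P := p j i) (by rwa [hj])
    exact ⟨_, ⟨((j, α), i), rfl⟩, hα⟩
  obtain ⟨a, ha⟩ := Finsupp.mem_ideal_span_range_iff_exists_finsupp.mp
    ((Ideal.eq_top_iff_one _).mp htop)
  have hΦ (x : X) := isProjectorAlong_map_sum_exchangeMatrix ((ψ x).comp MvPolynomial.C) (hq x) ha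
  refine ⟨_, ?_, hΦ⟩
  ext r r'
  refine MvPolynomial.C_injective σ A (hψ (funext fun x => ?_))
  have hidem := (hΦ x).isIdempotentElem
  rw [IsIdempotentElem, ← Matrix.map_mul] at hidem
  exact congrFun (congrFun hidem r) r'

end LocalToGlobal

section MatrixKernel

variable {R V κ ι : Type*} [CommRing R] [AddCommGroup V] [Module R V] [Fintype ι]

/-- The submodule of a free module cut out by the rows of `M`, seen as linear forms in the
coordinates with respect to the basis `b`. -/
noncomputable def matrixKernel (b : Module.Basis ι R V) (M : Matrix κ ι R) : Submodule R V :=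
  LinearMap.ker (M.mulVecLin ∘ₗ b.equivFun.toLinearMap)

variable {b : Module.Basis ι R V}

theorem mem_matrixKernel {M : Matrix κ ι R} {v : V} :
    v ∈ matrixKernel b M ↔ M.mulVec (b.equivFun v) = 0 :=
  Iff.rfl

theorem matrixKernel_le_iff {κ' : Type*} {Φ : Matrix ι ι R} (hΦ : IsIdempotentElem Φ)
    {M : Matrix κ' ι R} : matrixKernel b Φ ≤ matrixKernel b M ↔ M * Φ = M := by
  classical
  refine ⟨fun h => Eq.symm (sub_eq_zero.mp (Matrix.ext_of_mulVec_single fun r => ?_)),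
    fun h v hv => ?_⟩
  · let v : V := b.equivFun.symm ((1 - Φ).mulVec (Pi.single r 1))
    have hv : b.equivFun v = (1 - Φ).mulVec (Pi.single r 1) := LinearEquiv.apply_symm_apply _ _
    have hΦv : v ∈ matrixKernel b Φ := by
      rw [mem_matrixKernel, hv, Matrix.mulVec_mulVec, hΦ.mul_one_sub_self, Matrix.zero_mulVec]
    have hMv := mem_matrixKernel.mp (h hΦv)
    rwa [hv, Matrix.mulVec_mulVec, Matrix.mul_sub, Matrix.mul_one,
      ← Matrix.zero_mulVec (Pi.single r 1)] at hMv
  · rw [mem_matrixKernel] at hv ⊢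
    rw [← h, ← Matrix.mulVec_mulVec, hv, Matrix.mulVec_zero]

theorem IsProjectorAlong.matrixKernel_eq [Fintype κ] [DecidableEq κ] {Φ : Matrix ι ι R}
    {M : Matrix κ ι R} (h : IsProjectorAlong Φ M) : matrixKernel b Φ = matrixKernel b M := by
  obtain ⟨B, rfl, hMB⟩ := h
  ext v
  rw [mem_matrixKernel, mem_matrixKernel, ← Matrix.mulVec_mulVec]
  refine ⟨fun hv => ?_, fun hv => by rw [hv, Matrix.mulVec_zero]⟩
  have hMv := congrArg M.mulVec hv
  rwa [Matrix.mulVec_mulVec, hMB, Matrix.one_mulVec, Matrix.mulVec_zero] at hMv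

theorem isProjectorAlong_of_matrixKernel_eq [Fintype κ] [DecidableEq κ] {Φ : Matrix ι ι R}
    (hΦ : IsIdempotentElem Φ) {M : Matrix κ ι R} {N : Matrix ι κ R} (hMN : M * N = 1)
    (h : matrixKernel b Φ = matrixKernel b M) : IsProjectorAlong Φ M := by
  have hMΦ : M * Φ = M := (matrixKernel_le_iff hΦ).mp h.le
  have hNM : IsProjectorAlong (N * M) M := ⟨N, rfl, hMN⟩
  have hΦN : Φ * (N * M) = Φ :=
    (matrixKernel_le_iff hNM.isIdempotentElem).mp (hNM.matrixKernel_eq.trans h.symm).le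
  exact ⟨Φ * N, by rw [Matrix.mul_assoc, hΦN], by rw [← Matrix.mul_assoc, hMΦ, hMN]⟩

section ToMatrix

variable [DecidableEq ι]

theorem matrixKernel_toMatrix {V' : Type*} [AddCommGroup V'] [Module R V'] [Finite κ]
    (F : Module.Basis κ R V') (f : V →ₗ[R] V') :
    matrixKernel b (LinearMap.toMatrix b F f) = LinearMap.ker f := by
  ext v
  have hcoord : (LinearMap.toMatrix b F f).mulVec (b.equivFun v) = F.repr (f v) :=
    LinearMap.toMatrix_mulVec_repr b F f v
  rw [mem_matrixKernel, hcoord, LinearMap.mem_ker, ← F.repr.map_eq_zero_iff (x := f v)]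
  exact DFunLike.coe_fn_eq (g := (0 : κ →₀ R))

theorem matrixKernel_eq_ker_toLin (Φ : Matrix ι ι R) :
    matrixKernel b Φ = LinearMap.ker (Matrix.toLin b b Φ) := by
  rw [← matrixKernel_toMatrix (b := b) b, LinearMap.toMatrix_toLin]

theorem exists_toMatrix_mul_eq_one {V' : Type*} [AddCommGroup V'] [Module R V'] [Finite κ]
    [DecidableEq κ] (b : Module.Basis ι R V) (F : Module.Basis κ R V') {f : V →ₗ[R] V'}
    (hf : Function.Surjective f) : ∃ N : Matrix ι κ R, LinearMap.toMatrix b F f * N = 1 := by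
  cases nonempty_fintype κ
  have : Module.Projective R V' := .of_basis F
  obtain ⟨g, hg⟩ := Module.projective_lifting_property f LinearMap.id hf
  exact ⟨LinearMap.toMatrix F b g, by rw [← LinearMap.toMatrix_comp, hg, LinearMap.toMatrix_id]⟩

theorem maximalMinor_toMatrix {V' : Type*} [AddCommGroup V'] [Module R V'] [Fintype κ]
    [DecidableEq κ] (b : Module.Basis ι R V) (F : Module.Basis κ R V') (f : V →ₗ[R] V')
    (i : κ → ι) : maximalMinor (LinearMap.toMatrix b F f) i = F.det fun m => f (b (i m)) := by
  rw [maximalMinor, Module.Basis.det_apply]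
  congr 1
  ext m r
  simp only [Matrix.submatrix_apply, id_eq, LinearMap.toMatrix_apply, Module.Basis.toMatrix_apply]

theorem exists_splitting_of_isIdempotentElem {Φ : Matrix ι ι R} (hΦ : IsIdempotentElem Φ) :
    ∃ g : (V ⧸ matrixKernel b Φ) →ₗ[R] V, g ∘ₗ (matrixKernel b Φ).mkQ = Matrix.toLin b b Φ ∧
      (matrixKernel b Φ).mkQ ∘ₗ g = LinearMap.id := by
  have hker := matrixKernel_eq_ker_toLin (b := b) Φ
  refine ⟨(matrixKernel b Φ).liftQ (Matrix.toLin b b Φ) hker.le, Submodule.liftQ_mkQ _ _ _,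
    Submodule.linearMap_qext _ (LinearMap.ext fun v => ?_)⟩
  have hv : Matrix.toLin b b Φ v - v ∈ matrixKernel b Φ := by
    rw [hker, LinearMap.mem_ker, map_sub, ← Matrix.toLin_mul_apply, hΦ.eq, sub_self]
  simpa only [LinearMap.comp_apply, LinearMap.id_apply, Submodule.mkQ_apply,
    Submodule.liftQ_apply] using (Submodule.Quotient.eq _).mpr hv

end ToMatrix

theorem exists_isIdempotentElem_matrixKernel_eq (b : Module.Basis ι R V) (W : Submodule R V)
    [Module.Projective R (V ⧸ W)] :
    ∃ Φ : Matrix ι ι R, IsIdempotentElem Φ ∧ matrixKernel b Φ = W := by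
  classical
  obtain ⟨g, hg⟩ := Module.projective_lifting_property W.mkQ LinearMap.id W.mkQ_surjective
  have hg_inj : LinearMap.ker g = ⊥ := LinearMap.ker_eq_bot_of_inverse hg
  refine ⟨LinearMap.toMatrix b b (g ∘ₗ W.mkQ), ?_, ?_⟩
  · rw [IsIdempotentElem, ← LinearMap.toMatrix_comp, LinearMap.comp_assoc,
      ← LinearMap.comp_assoc _ g, hg, LinearMap.id_comp]
  · rw [matrixKernel_toMatrix, LinearMap.ker_comp_of_ker_eq_bot _ hg_inj, Submodule.ker_mkQ]

theorem projective_quotient_matrixKernel {Φ : Matrix ι ι R} (hΦ : IsIdempotentElem Φ) :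
    Module.Projective R (V ⧸ matrixKernel b Φ) := by
  classical
  have : Module.Projective R V := .of_basis b
  obtain ⟨g, -, hg⟩ := exists_splitting_of_isIdempotentElem (b := b) hΦ
  exact .of_split g _ hg

end MatrixKernel

section BaseChange

universe w

variable {k E ι : Type*} [CommRing k] [AddCommGroup E] [Module k E] [Fintype ι]
  {b : Module.Basis ι k E} {A R : Type w} [CommRing A] [Algebra k A] [CommRing R] [Algebra k R]
  {Φ : Matrix ι ι A} {l : ℕ}

theorem toLin_map_algebraMap [DecidableEq ι] [Algebra A R] [IsScalarTower k A R] :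
    Matrix.toLin (b.baseChange R) (b.baseChange R) (Φ.map (algebraMap A R)) =
      (TensorProduct.AlgebraTensorModule.cancelBaseChange k A R R E).toLinearMap ∘ₗ
        (Matrix.toLin (b.baseChange A) (b.baseChange A) Φ).baseChange R ∘ₗ
          (TensorProduct.AlgebraTensorModule.cancelBaseChange k A R R E).symm.toLinearMap := by
  refine (b.baseChange R).ext fun r => ?_
  have hr := Matrix.toLin_self (b.baseChange A) (b.baseChange A) Φ r
  simp only [Module.Basis.baseChange_apply] at hr
  rw [Matrix.toLin_self]
  simp [hr, TensorProduct.tmul_sum, TensorProduct.smul_tmul', Algebra.smul_def]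

theorem ker_baseChangeMkQ_matrixKernel [Algebra A R] [IsScalarTower k A R]
    (hΦ : IsIdempotentElem Φ) :
    LinearMap.ker (Module.Grassmannian.baseChangeMkQ R (matrixKernel (b.baseChange A) Φ)) =
      matrixKernel (b.baseChange R) (Φ.map (algebraMap A R)) := by
  classical
  obtain ⟨g, hg, hg'⟩ := exists_splitting_of_isIdempotentElem (b := b.baseChange A) hΦ
  have hker : LinearMap.ker (g.baseChange R) = ⊥ := by
    refine LinearMap.ker_eq_bot_of_inverse (g := (matrixKernel _ Φ).mkQ.baseChange R) ?_
    rw [← LinearMap.baseChange_comp, hg', LinearMap.baseChange_id]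
  rw [matrixKernel_eq_ker_toLin (b := b.baseChange R), toLin_map_algebraMap,
    LinearEquiv.ker_comp, ← hg, LinearMap.baseChange_comp, LinearMap.comp_assoc,
    LinearMap.ker_comp_of_ker_eq_bot _ hker]
  rfl

theorem map_toSubmodule_of_isIdempotentElem (f : A →ₐ[k] R)
    (W : Module.Grassmannian A (A ⊗[k] E) l) (hΦ : IsIdempotentElem Φ)
    (hW : W.toSubmodule = matrixKernel (b.baseChange A) Φ) :
    (Module.Grassmannian.map f W).toSubmodule = matrixKernel (b.baseChange R) (Φ.map f) := by
  let _ : Algebra A R := f.toAlgebra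
  have : IsScalarTower k A R := .of_algebraMap_eq' f.comp_algebraMap.symm
  rw [Module.Grassmannian.map_toSubmodule, hW]
  exact ker_baseChangeMkQ_matrixKernel hΦ

theorem rankAtStalk_quotient_matrixKernel (f : A →ₐ[k] R) (hΦ : IsIdempotentElem Φ)
    (W : Module.Grassmannian R (R ⊗[k] E) l)
    (hW : W.toSubmodule = matrixKernel (b.baseChange R) (Φ.map f)) (c : PrimeSpectrum R) :
    Module.rankAtStalk (R := A) ((A ⊗[k] E) ⧸ matrixKernel (b.baseChange A) Φ)
      (PrimeSpectrum.comap f.toRingHom c) = l := by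
  let _ : Algebra A R := f.toAlgebra
  have : IsScalarTower k A R := .of_algebraMap_eq' f.comp_algebraMap.symm
  have := projective_quotient_matrixKernel (b := b.baseChange A) hΦ
  have : Module.Finite k E := .of_basis b
  have hker : W.toSubmodule = LinearMap.ker
      (Module.Grassmannian.baseChangeMkQ R (matrixKernel (b.baseChange A) Φ)) :=
    hW.trans (ker_baseChangeMkQ_matrixKernel hΦ).symm
  rw [← W.rankAtStalk_eq c, Module.rankAtStalk_eq_of_equiv (Submodule.quotEquivOfEq _ _ hker),
    Module.rankAtStalk_eq_of_equiv (Module.Grassmannian.baseChangeMkQEquiv (B := R) _),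
    Module.rankAtStalk_baseChange]
  rfl

theorem exists_grassmannian_toSubmodule_eq {X : Type*} {O : X → Type w} [∀ x, CommRing (O x)]
    [∀ x, IsLocalRing (O x)] [∀ x, Algebra k (O x)] {φ : ∀ x, A →ₐ[k] O x}
    (hφ : ∀ m : Ideal A, m.IsMaximal → ∃ x, ∀ a ∈ m, ¬IsUnit (φ x a))
    (hΦ : IsIdempotentElem Φ) (W : ∀ x, Module.Grassmannian (O x) (O x ⊗[k] E) l)
    (hW : ∀ x, (W x).toSubmodule = matrixKernel (b.baseChange (O x)) (Φ.map (φ x))) :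
    ∃ W₀ : Module.Grassmannian A (A ⊗[k] E) l,
      W₀.toSubmodule = matrixKernel (b.baseChange A) Φ := by
  have hproj := projective_quotient_matrixKernel (b := b.baseChange A) hΦ
  have : Module.Finite k E := .of_basis b
  refine ⟨⟨matrixKernel (b.baseChange A) Φ, inferInstance, hproj, fun c => ?_⟩, rfl⟩
  obtain ⟨m, hm, hcm⟩ := Ideal.exists_le_maximal c.asIdeal c.isPrime.ne_top
  obtain ⟨x, hx⟩ := hφ m hm
  have hmx : m ≤ (PrimeSpectrum.comap (φ x).toRingHom (IsLocalRing.closedPoint _)).asIdeal := hx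
  rw [Module.rankAtStalk_eq_of_le_of_finite_of_flat _ (hcm.trans hmx)]
  exact rankAtStalk_quotient_matrixKernel (φ x) hΦ (W x) (hW x) _

theorem le_of_map_localization_eq [Module.Free k E] [Module.Finite k E]
    {W W' : Module.Grassmannian A (A ⊗[k] E) l}
    (h : ∀ (m : Ideal A) [m.IsMaximal],
      Module.Grassmannian.map (Algebra.algHom k A (Localization.AtPrime m)) W =
        Module.Grassmannian.map (Algebra.algHom k A (Localization.AtPrime m)) W') :
    W.toSubmodule ≤ W'.toSubmodule := by
  let b := Module.Free.chooseBasis k E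
  obtain ⟨Φ, hΦ, hW⟩ := exists_isIdempotentElem_matrixKernel_eq (b.baseChange A) W.toSubmodule
  obtain ⟨Φ', hΦ', hW'⟩ := exists_isIdempotentElem_matrixKernel_eq (b.baseChange A) W'.toSubmodule
  rw [← hW, ← hW', matrixKernel_le_iff hΦ]
  ext r r'
  refine Module.eq_of_localization_maximal (fun m _ => Localization.AtPrime m)
    (fun m _ => Algebra.linearMap A (Localization.AtPrime m)) _ _ fun m _ => ?_
  let f := Algebra.algHom k A (Localization.AtPrime m)
  have hle : matrixKernel (b.baseChange _) (Φ.map f) ≤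
      matrixKernel (b.baseChange _) (Φ'.map f) := by
    rw [← map_toSubmodule_of_isIdempotentElem f W hΦ hW.symm,
      ← map_toSubmodule_of_isIdempotentElem f W' hΦ' hW'.symm, h m]
  have hΦf : IsIdempotentElem (Φ.map f) := hΦ.map f.mapMatrix
  rw [matrixKernel_le_iff hΦf, ← Matrix.map_mul] at hle
  exact congrFun (congrFun hle r) r'

theorem eq_of_map_localization_eq [Module.Free k E] [Module.Finite k E]
    {W W' : Module.Grassmannian A (A ⊗[k] E) l}
    (h : ∀ (m : Ideal A) [m.IsMaximal],
      Module.Grassmannian.map (Algebra.algHom k A (Localization.AtPrime m)) W =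
        Module.Grassmannian.map (Algebra.algHom k A (Localization.AtPrime m)) W') :
    W = W' :=
  Module.Grassmannian.ext <|
    (le_of_map_localization_eq h).antisymm (le_of_map_localization_eq fun m _ => (h m).symm)

end BaseChange

section PluckerCoordinates

variable {k : Type u} [Field k] {R : Type u} [CommRing R] [Algebra k R] {s l : ℕ}

theorem IsPluckerCoordinates.exists_matrix {W : Module.Grassmannian R (R ⊗[k] (Fin s → k)) l}
    {P : (Fin l → Fin s) → R} (h : IsPluckerCoordinates W P) :
    ∃ (M : Matrix (Fin l) (Fin s) R) (N : Matrix (Fin s) (Fin l) R), M * N = 1 ∧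
      matrixKernel ((Pi.basisFun k (Fin s)).baseChange R) M = W.toSubmodule ∧
      ∀ i, P i = maximalMinor M i := by
  obtain ⟨F, hF⟩ := h
  let b := (Pi.basisFun k (Fin s)).baseChange R
  obtain ⟨N, hN⟩ := exists_toMatrix_mul_eq_one b F W.toSubmodule.mkQ_surjective
  refine ⟨LinearMap.toMatrix b F W.toSubmodule.mkQ, N, hN, ?_, fun i => ?_⟩
  · rw [matrixKernel_toMatrix, Submodule.ker_mkQ]
  · simp only [hF, maximalMinor_toMatrix, b, Module.Basis.baseChange_apply, Pi.basisFun_apply]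

end PluckerCoordinates

section AffineSchemes

variable {k : Type u} [Field k] {A R S : Type u} [CommRing A] [Algebra k A] [CommRing R]
  [Algebra k R] [CommRing S] [Algebra k S]

/-- The morphism of `k`-schemes `Spec R ⟶ Spec A` induced by a homomorphism of `k`-algebras. -/
noncomputable def specMap (f : A →ₐ[k] R) : specOver k R ⟶ specOver k A :=
  (algSpec (CommRingCat.of k)).map (CommAlgCat.ofHom f).op

/-- The homomorphism of `k`-algebras underlying a morphism of affine `k`-schemes. -/
noncomputable def algHomOfSpecHom (φ : specOver k R ⟶ specOver k A) : A →ₐ[k] R :=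
  ((algSpec.fullyFaithful (R := CommRingCat.of k)).preimage φ).unop.hom

theorem specMap_algHomOfSpecHom (φ : specOver k R ⟶ specOver k A) :
    specMap (algHomOfSpecHom φ) = φ :=
  (algSpec.fullyFaithful (R := CommRingCat.of k)).map_preimage φ

theorem algHomOfSpecHom_specMap (f : A →ₐ[k] R) : algHomOfSpecHom (specMap f) = f :=
  congrArg (fun g => g.unop.hom)
    ((algSpec.fullyFaithful (R := CommRingCat.of k)).preimage_map (CommAlgCat.ofHom f).op)

theorem specMap_comp (f : R →ₐ[k] S) (g : A →ₐ[k] R) :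
    specMap (f.comp g) = specMap f ≫ specMap g := by
  rw [specMap, CommAlgCat.ofHom_comp, op_comp]
  exact (algSpec (CommRingCat.of k)).map_comp _ _

theorem algHomOfSpecHom_specMap_comp (f : R →ₐ[k] S) (φ : specOver k R ⟶ specOver k A) :
    algHomOfSpecHom (specMap f ≫ φ) = f.comp (algHomOfSpecHom φ) := by
  rw [← algHomOfSpecHom_specMap (f.comp _), specMap_comp, specMap_algHomOfSpecHom]

theorem spec_map_algHomOfSpecHom (φ : specOver k R ⟶ specOver k A) :
    Spec.map (CommRingCat.ofHom (algHomOfSpecHom φ).toRingHom) = φ.left :=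
  congrArg CommaMorphism.left (specMap_algHomOfSpecHom φ)

end AffineSchemes

section GrassmannianMorphisms

variable {k : Type u} [Field k] {s l : ℕ} {X : Over (Spec (CommRingCat.of k))}
  {A R S : Type u} [CommRing A] [Algebra k A] [CommRing R] [Algebra k R] [CommRing S] [Algebra k S]

/-- The morphism `Spec A ⟶ 𝔾` corresponding to an `A`-point of the Grassmannian `𝔾`. -/
noncomputable def GrassmannianMorphism.ofPoint
    (W : Module.Grassmannian A (A ⊗[k] (Fin s → k)) l) :
    GrassmannianMorphism (specOver k A) s l where
  app R := ↾fun φ => Module.Grassmannian.map (algHomOfSpecHom φ) W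
  naturality R S f := by
    refine ConcreteCategory.hom_ext _ _ fun φ => ?_
    refine (congrArg (Module.Grassmannian.map · W) (algHomOfSpecHom_specMap_comp f.hom φ)).trans ?_
    exact Module.Grassmannian.map_comp _ _ _ W

theorem GrassmannianMorphism.app_specMap_comp (h : GrassmannianMorphism X s l) (f : R →ₐ[k] S)
    (y : specOver k R ⟶ X) :
    h.app (CommAlgCat.of k S) (specMap f ≫ y) =
      Module.Grassmannian.map f (h.app (CommAlgCat.of k R) y) :=
  ConcreteCategory.congr_hom (h.naturality (CommAlgCat.ofHom f)) y

theorem GrassmannianMorphism.app_eq_map_algHomOfSpecHom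
    (g : GrassmannianMorphism (specOver k A) s l) (φ : specOver k R ⟶ specOver k A) :
    g.app (CommAlgCat.of k R) φ =
      Module.Grassmannian.map (algHomOfSpecHom φ) (g.app (CommAlgCat.of k A) (𝟙 _)) := by
  rw [← g.app_specMap_comp, specMap_algHomOfSpecHom]
  exact congrArg (g.app _) (Category.comp_id φ).symm

end GrassmannianMorphisms

section Points

variable {k : Type u} [Field k] {s l : ℕ} {X : Over (Spec (CommRingCat.of k))}
  {A R : Type u} [CommRing A] [Algebra k A] [CommRing R] [Algebra k R]

instance isLocalRing_stalkAlgebra (x : X.left) : IsLocalRing (stalkAlgebra X x) :=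
  inferInstanceAs (IsLocalRing (X.left.presheaf.stalk x))

theorem exists_eq_specMap_comp_stalkPoint [IsLocalRing R] (y : specOver k R ⟶ X) :
    ∃ (x : X.left) (f : stalkAlgebra X x →ₐ[k] R), y = specMap f ≫ stalkPoint X x := by
  have : IsLocalRing (CommRingCat.of R) := ‹IsLocalRing R›
  let y' : Spec (CommRingCat.of R) ⟶ X.left := y.left
  let x : X.left := y' (IsLocalRing.closedPoint R)
  have hy' : Spec.map (Scheme.stalkClosedPointTo y') ≫ X.left.fromSpecStalk x = y' :=
    Scheme.Spec_stalkClosedPointTo_fromSpecStalk y'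
  let z : specOver k R ⟶ specOver k (stalkAlgebra X x) :=
    Over.homMk (Spec.map (Scheme.stalkClosedPointTo y')) (by
      refine (congrArg (Spec.map (Scheme.stalkClosedPointTo y') ≫ ·)
        (Over.w (stalkPoint X x)).symm).trans ?_
      refine (Category.assoc _ _ _).symm.trans ?_
      exact (congrArg (· ≫ X.hom) hy').trans (Over.w y))
  refine ⟨x, algHomOfSpecHom z, ?_⟩
  rw [specMap_algHomOfSpecHom]
  exact Over.OverMorphism.ext hy'.symm

theorem GrassmannianMorphism.ext_of_localize {h h' : GrassmannianMorphism X s l}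
    (hx : ∀ x, h.localize x = h'.localize x) : h = h' := by
  refine NatTrans.ext (funext fun R => ConcreteCategory.hom_ext _ _ fun y => ?_)
  refine eq_of_map_localization_eq fun m _ => ?_
  let f := Algebra.algHom k R (Localization.AtPrime m)
  obtain ⟨x, g, hg⟩ := exists_eq_specMap_comp_stalkPoint (specMap f ≫ y)
  have hf : h.app _ (specMap f ≫ y) = h'.app _ (specMap f ≫ y) := by
    rw [hg, h.app_specMap_comp, h'.app_specMap_comp]
    exact congrArg _ (hx x)
  rwa [h.app_specMap_comp, h'.app_specMap_comp] at hf

/-- The homomorphism of `k`-algebras `A → 𝒪_{X,x}` induced by a `k`-morphism `X ⟶ Spec A`. -/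
noncomputable def toStalk (q : X ⟶ specOver k A) (x : X.left) : A →ₐ[k] stalkAlgebra X x :=
  algHomOfSpecHom (stalkPoint X x ≫ q)

theorem GrassmannianMorphism.localize_precomp (g : GrassmannianMorphism (specOver k A) s l)
    (q : X ⟶ specOver k A) (x : X.left) :
    (g.precomp q).localize x =
      Module.Grassmannian.map (toStalk q x) (g.app (CommAlgCat.of k A) (𝟙 _)) :=
  g.app_eq_map_algHomOfSpecHom (R := stalkAlgebra X x) _

theorem spec_map_toStalk (q : X ⟶ specOver k A) (x : X.left) :
    Spec.map (CommRingCat.ofHom (toStalk q x).toRingHom) = X.left.fromSpecStalk x ≫ q.left :=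
  spec_map_algHomOfSpecHom _

theorem comap_toStalk_closedPoint (q : X ⟶ specOver k A) (x : X.left) :
    PrimeSpectrum.comap (toStalk q x).toRingHom (IsLocalRing.closedPoint (stalkAlgebra X x)) =
      q.left x := by
  refine (congrArg (fun φ => φ (IsLocalRing.closedPoint (X.left.presheaf.stalk x)))
    (spec_map_toStalk q x)).trans ((Scheme.Hom.comp_apply _ _ _).trans ?_)
  exact congrArg q.left Scheme.fromSpecStalk_closedPoint

theorem exists_forall_mem_not_isUnit_toStalk {q : X ⟶ specOver k A}
    (hq : ∀ c : (specOver k A).left, IsClosed {c} → ∃ x : X.left, q.left x = c)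
    (m : Ideal A) (hm : m.IsMaximal) : ∃ x : X.left, ∀ a ∈ m, ¬IsUnit (toStalk q x a) := by
  let c : PrimeSpectrum A := ⟨m, hm.isPrime⟩
  obtain ⟨x, hx⟩ := hq c ((PrimeSpectrum.isClosed_singleton_iff_isMaximal c).mpr hm)
  have hc : PrimeSpectrum.comap (toStalk q x).toRingHom (IsLocalRing.closedPoint _) = c :=
    (comap_toStalk_closedPoint q x).trans hx
  exact ⟨x, (congrArg PrimeSpectrum.asIdeal hc).ge⟩

variable {M : ∀ x, Matrix (Fin l) (Fin s) (stalkAlgebra X x)}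

theorem exists_isProjectorAlong_localize_precomp {q : X ⟶ specOver k A}
    (g : GrassmannianMorphism (specOver k A) s l)
    (hM : ∀ x, ∃ N : Matrix (Fin s) (Fin l) (stalkAlgebra X x), M x * N = 1)
    (hker : ∀ x, matrixKernel ((Pi.basisFun k (Fin s)).baseChange _) (M x) =
      ((g.precomp q).localize x).toSubmodule) :
    ∃ Φ : Matrix (Fin s) (Fin s) A, ∀ x, IsProjectorAlong (Φ.map (toStalk q x)) (M x) := by
  let W : Module.Grassmannian A (A ⊗[k] (Fin s → k)) l := g.app (CommAlgCat.of k A) (𝟙 _)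
  obtain ⟨Φ, hΦ, hW⟩ := exists_isIdempotentElem_matrixKernel_eq
    ((Pi.basisFun k (Fin s)).baseChange A) W.toSubmodule
  refine ⟨Φ, fun x => ?_⟩
  obtain ⟨N, hMN⟩ := hM x
  refine isProjectorAlong_of_matrixKernel_eq (hΦ.map (toStalk q x).mapMatrix) hMN
    (b := (Pi.basisFun k (Fin s)).baseChange _) ?_
  rw [hker, g.localize_precomp]
  exact (map_toSubmodule_of_isIdempotentElem (toStalk q x) W hΦ hW.symm).symm

theorem exists_eq_precomp_of_isProjectorAlong {q : X ⟶ specOver k A}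
    (hq : ∀ c : (specOver k A).left, IsClosed {c} → ∃ x : X.left, q.left x = c)
    {h : GrassmannianMorphism X s l}
    (hker : ∀ x, matrixKernel ((Pi.basisFun k (Fin s)).baseChange _) (M x) =
      (h.localize x).toSubmodule)
    {Φ : Matrix (Fin s) (Fin s) A} (hΦ : IsIdempotentElem Φ)
    (hproj : ∀ x, IsProjectorAlong (Φ.map (toStalk q x)) (M x)) :
    ∃ g : GrassmannianMorphism (specOver k A) s l, h = g.precomp q := by
  have hloc (x : X.left) : (h.localize x).toSubmodule =
      matrixKernel ((Pi.basisFun k (Fin s)).baseChange _) (Φ.map (toStalk q x)) := by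
    rw [← hker, (hproj x).matrixKernel_eq]
  obtain ⟨W, hW⟩ := exists_grassmannian_toSubmodule_eq
    (exists_forall_mem_not_isUnit_toStalk hq) hΦ h.localize hloc
  refine ⟨.ofPoint W, GrassmannianMorphism.ext_of_localize fun x => Module.Grassmannian.ext ?_⟩
  rw [hloc]
  exact (map_toSubmodule_of_isIdempotentElem (toStalk q x) W hΦ hW).symm

end Points

section Functions

variable {k : Type u} [Field k] {X : Over (Spec (CommRingCat.of k))}
  {A : Type u} [CommRing A] [Algebra k A]

/-- The pullback `q^* : A → 𝒪_X(X)` of functions along a `k`-morphism `q : X ⟶ Spec A`. -/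
noncomputable def pullbackHom (q : X ⟶ specOver k A) : A →+* Γ(X.left, ⊤) :=
  q.left.appTop.hom.comp (Scheme.ΓSpecIso (CommRingCat.of A)).inv.hom

/-- The germ of global sections at `x`, as a ring homomorphism. -/
noncomputable def germHom (X : Over (Spec (CommRingCat.of k))) (x : X.left) :
    Γ(X.left, ⊤) →+* stalkAlgebra X x :=
  (X.left.presheaf.germ ⊤ x trivial).hom

theorem pi_germHom_injective : Function.Injective (RingHom.pi (germHom X)) :=
  fun t t' h => TopCat.Presheaf.section_ext X.left.sheaf ⊤ t t' fun x _ => congrFun h x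

theorem germHom_comp_pullbackHom (q : X ⟶ specOver k A) (x : X.left) :
    (germHom X x).comp (pullbackHom q) = (toStalk q x).toRingHom := by
  let q' : X.left ⟶ Spec (CommRingCat.of A) := q.left
  let φ : CommRingCat.of A ⟶ X.left.presheaf.stalk x := CommRingCat.ofHom (toStalk q x).toRingHom
  have htop : (Spec.map φ).appTop = (X.left.fromSpecStalk x ≫ q').appTop :=
    congrArg Scheme.Hom.appTop (spec_map_toStalk q x)
  have hφ : φ = (Scheme.ΓSpecIso (CommRingCat.of A)).inv ≫ q'.appTop ≫
      X.left.presheaf.germ ⊤ x trivial := by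
    rw [Scheme.Hom.comp_appTop, Scheme.fromSpecStalk_appTop] at htop
    rw [← cancel_mono (Scheme.ΓSpecIso (X.left.presheaf.stalk x)).inv,
      Scheme.ΓSpecIso_inv_naturality, htop]
    simp only [Category.assoc]
    rfl
  exact congrArg CommRingCat.Hom.hom hφ.symm

end Functions

section PullbackHom

variable {k : Type u} [Field k] {X : Over (Spec (CommRingCat.of k))}
  {A R : Type u} [CommRing A] [Algebra k A] [CommRing R] [Algebra k R]

theorem pullbackHom_comp_specMap (q : X ⟶ specOver k R) (f : A →ₐ[k] R) :
    pullbackHom (q ≫ specMap f) = (pullbackHom q).comp f.toRingHom := by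
  let q' : X.left ⟶ Spec (CommRingCat.of R) := q.left
  let φ : CommRingCat.of A ⟶ CommRingCat.of R := CommRingCat.ofHom f.toRingHom
  have hφ : (Scheme.ΓSpecIso (CommRingCat.of A)).inv ≫ (q' ≫ Spec.map φ).appTop =
      φ ≫ (Scheme.ΓSpecIso (CommRingCat.of R)).inv ≫ q'.appTop := by
    rw [Scheme.Hom.comp_appTop, ← Scheme.ΓSpecIso_inv_naturality_assoc]
  exact congrArg CommRingCat.Hom.hom hφ

theorem appTop_injective_of_isAffine {X Y : Scheme.{u}} [IsAffine Y] (f : X ⟶ Y)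
    [IsSchemeTheoreticallyDominant f] : Function.Injective f.appTop := by
  have hker := f.ker_eq_bot
  rw [Scheme.ker_of_isAffine] at hker
  have htop := congrArg (fun I : Y.IdealSheafData => I.ideal ⟨⊤, isAffineOpen_top Y⟩) hker
  simp only [Scheme.IdealSheafData.ofIdealTop_ideal] at htop
  rw [RingHom.injective_iff_ker_eq_bot]
  simpa using htop

theorem pullbackHom_injective (q : X ⟶ specOver k A) [IsSchemeTheoreticallyDominant q.left] :
    Function.Injective (pullbackHom q) := by
  have : IsAffine (specOver k A).left := inferInstanceAs (IsAffine (Spec (CommRingCat.of A)))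
  exact (appTop_injective_of_isAffine q.left).comp
    (ConcreteCategory.bijective_of_isIso (Scheme.ΓSpecIso (CommRingCat.of A)).inv).1

theorem ofPolynomial_injective (k : Type u) [Field k] (A : Type u) [CommRing A] [Algebra k A]
    (n : ℕ) : Function.Injective (ofPolynomial k A n) := by
  let f : MvPolynomial (Fin (n + 1)) k →ₐ[k] RatFun k n := IsScalarTower.toAlgHom k _ _
  have hfactor : ofPolynomial k A n = (Algebra.TensorProduct.map (AlgHom.id A A) f).comp
      (MvPolynomial.algebraTensorAlgEquiv k A).symm.toAlgHom := by
    ext m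
    simp [ofPolynomial, f]
  have hf : Function.Injective (Algebra.TensorProduct.map (AlgHom.id A A) f) :=
    Module.Flat.lTensor_preserves_injective_linearMap (M := A) f.toLinearMap
      (IsFractionRing.injective _ _)
  rw [hfactor]
  exact hf.comp (MvPolynomial.algebraTensorAlgEquiv k A).symm.injective

theorem pullbackHom_comp_ofPolynomial_comp_C {n : ℕ} (e : X ⟶ specOver k (GenericExtension k A n)) :
    ((pullbackHom e).comp (ofPolynomial k A n).toRingHom).comp MvPolynomial.C =
      pullbackHom (e ≫ firstProjection k A n) := by
  refine Eq.trans ?_ (pullbackHom_comp_specMap e Algebra.TensorProduct.includeLeft).symm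
  exact congrArg (pullbackHom e).comp (ofPolynomial k A n).comp_algebraMap

end PullbackHom

end GrassmannianFactorisation

open GrassmannianFactorisation in
theorem mainTheorem7_general {k : Type u} [Field k] {A : Type u} [CommRing A] [Algebra k A]
    {s l : ℕ} {σ : Type*} {X : Over (Spec (CommRingCat.of k))} (q : X ⟶ specOver k A)
    (hq : ∀ c : (specOver k A).left, IsClosed {c} → ∃ x : X.left, q.left x = c)
    {f : MvPolynomial σ A →+* Γ(X.left, ⊤)} (hf : Function.Injective f)
    (hfC : f.comp MvPolynomial.C = pullbackHom q) (h : GrassmannianMorphism X s l)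
    {J : Type*} (p : J → (Fin l → Fin s) → MvPolynomial σ A)
    (hp : IsSuperabundant h fun j i => f (p j i)) :
    (∃ g : GrassmannianMorphism (specOver k A) s l, h = g.precomp q) ↔
      ∀ (i₁ i₂ : Fin l → Fin s) (j₁ j₂ : J) (α₁ α₂ : σ →₀ ℕ),
        (p j₁ i₁).coeff α₁ * (p j₂ i₂).coeff α₂ = (p j₁ i₂).coeff α₁ * (p j₂ i₁).coeff α₂ := by
  choose j₀ hj₀ hb using hp
  choose M N hMN hker hM using fun x => (hj₀ x).exists_matrix
  let ψ (x : X.left) : MvPolynomial σ A →+* stalkAlgebra X x := (germHom X x).comp f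
  have hψ : Function.Injective (RingHom.pi ψ) := pi_germHom_injective.comp hf
  have hψC (x : X.left) : ⇑((ψ x).comp MvPolynomial.C) = toStalk q x := by
    rw [RingHom.comp_assoc, hfC, germHom_comp_pullbackHom]
    rfl
  have hmax (m : Ideal A) (hm : m.IsMaximal) :
      ∃ x, ∀ a ∈ m, ¬IsUnit (ψ x (MvPolynomial.C a)) := by
    obtain ⟨x, hx⟩ := exists_forall_mem_not_isUnit_toStalk hq m hm
    exact ⟨x, fun a ha => (congrFun (hψC x) a).symm ▸ hx a ha⟩
  constructor
  · rintro ⟨g, rfl⟩ i₁ i₂ j₁ j₂ α₁ α₂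
    obtain ⟨Φ, hΦ⟩ := exists_isProjectorAlong_localize_precomp g (fun x => ⟨N x, hMN x⟩) hker
    refine isProportional_coeff_of_isProjectorAlong hψ hmax (fun x j => ?_)
      (fun x => (hψC x).symm ▸ hΦ x) j₁ j₂ α₁ α₂ i₁ i₂
    obtain ⟨b, hb⟩ := hb x j
    exact ⟨b, fun i => (hb i).trans (congrArg (b * ·) (hM x i))⟩
  · intro hcoeff
    obtain ⟨Φ, hΦ, hproj⟩ := exists_isProjectorAlong_of_isProportional_coeff hψ hmax
      (fun x => exists_isUnit_maximalMinor (hMN x)) (fun x => ⟨j₀ x, hM x⟩)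
      fun j₁ j₂ α₁ α₂ i₁ i₂ => hcoeff i₁ i₂ j₁ j₂ α₁ α₂
    exact exists_eq_precomp_of_isProjectorAlong hq hker hΦ fun x => hψC x ▸ hproj x

theorem mainTheorem7 {k : Type u} [Field k] {A : Type u} [CommRing A] [Algebra k A]
    {n s l : ℕ}
    {U : Over (Spec (CommRingCat.of k))}
    (e : U ⟶ GrassmannianFactorisation.specOver k
      (GrassmannianFactorisation.GenericExtension k A n))
    (he : IsOpenImmersion e.left)
    (he_dominant : IsSchemeTheoreticallyDominant e.left)
    (hpr_dominant : IsSchemeTheoreticallyDominant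
      (e ≫ GrassmannianFactorisation.firstProjection k A n).left)
    (hpr_closed : ∀ c : (GrassmannianFactorisation.specOver k A).left, IsClosed {c} →
      ∃ x : U.left, (e ≫ GrassmannianFactorisation.firstProjection k A n).left x = c)
    (h : GrassmannianFactorisation.GrassmannianMorphism U s l)
    {J : Type*} (p : J → (Fin l → Fin s) → MvPolynomial (Fin (n + 1)) A)
    (hp : GrassmannianFactorisation.IsSuperabundant h fun j i =>
      GrassmannianFactorisation.pullbackFunction e
        (GrassmannianFactorisation.ofPolynomial k A n (p j i))) :
    (∃ g : GrassmannianFactorisation.GrassmannianMorphism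
        (GrassmannianFactorisation.specOver k A) s l,
      h = g.precomp (e ≫ GrassmannianFactorisation.firstProjection k A n)) ↔
    ∀ (i₁ i₂ : Fin l → Fin s) (j₁ j₂ : J) (α₁ α₂ : Fin (n + 1) →₀ ℕ),
      (p j₁ i₁).coeff α₁ * (p j₂ i₂).coeff α₂ =
        (p j₁ i₂).coeff α₁ * (p j₂ i₁).coeff α₂ := by
  exact mainTheorem7_general (e ≫ GrassmannianFactorisation.firstProjection k A n) hpr_closed
    ((GrassmannianFactorisation.pullbackHom_injective e).comp
      (GrassmannianFactorisation.ofPolynomial_injective k A n))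
    (GrassmannianFactorisation.pullbackHom_comp_ofPolynomial_comp_C e) h p hp
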